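/- Let $r\ge 2$. Consider the $(2r-1)$th-order finite volume WENO schemes for $u_t+f(u)_x=0$ ($f$ differentiable) on the uniform meshes of $N$ cells $I_j=[x_{j-1/2},x_{j+1/2}]$ of $[x_l,x_r]$, $\Delta x=(x_r-x_l)/N$, with the global Lax--Friedrichs flux $\hat f(a,b)=\frac12[f(a)+f(b)-\alpha(b-a)]$, $\alpha=\sup|f'|$ over the range of $u$ on $[x_l,x_r]$. The reconstruction is $u^-_{j+1/2}=\sum_{s=0}^{r-1}\omega_s u^s_{j+1/2}$, where $u^s_{j+1/2}=p_s(x_{j+1/2})$ and $p_s$ is the polynomial of degree $<r$ with the given averages on the cells $I_{j+s-r+1},\dots,I_{j+s}$; $u^+_{j+1/2}$ is obtained by mirror symmetry. Let $d_s=\binom rs\binom{r-1}{s}/\binom{2r-1}{r}$ be the ideal weights (those for which $\sum_s d_su^s_{j+1/2}$ is the reconstruction from the whole $(2r-1)$-cell stencil), let $\beta_s=\sum_{l=1}^{r-1}\Delta x^{2l-1}\int_{I_j}(p_s^{(l)})^2dx$, and let $$\omega_s^{JS}=\frac{\alpha_s}{\sum_l\alpha_l},\qquad \alpha_s=\frac{d_s}{(\epsilon+\beta_s)^2},\qquad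 \epsilon\ge 0 .$$ Let X be any mapped scheme, with mapping functions $g^X_s(\omega)=g^X(\omega;P_{s,1},\dots,P_{s,m_P})$ depending on $s$ only through the real parameters $P_{s,i}$. The WENO-X scheme uses the weights $\omega_s^X=g^X_s(\omega^{JS}_s)/\sum_l g^X_l(\omega_l^{JS})$. The MOP-WENO-X scheme uses $\omega_s^{MOP\text{-}X}=\gamma_s/\sum_l\gamma_l$ with $\gamma_s=g^X_{k^*_s}(\omega_s^{JS})$, where $k_s^*$ is the smallest index $k$ that minimizes $|\omega_s^{JS}-d_k|$. Let $x_0\in(x_l,x_r)$ be a point near which $u$ is smooth, and let $I_{j(N)}$ be cells of the $N$th mesh whose centres tend to $x_0$ as $N\to\infty$. Assume either that $\epsilon>0$, or that $\epsilon=0$ and $x_0$ is a point of critical order $n_{cp}<r-1$ of $u$, i.e. $u'(x_0)=\dots=u^{(n_{cp})}(x_0)=0\ne u^{(n_{cp}+1)}(x_0)$ ($n_{cp}=0$ means $u'(x_0)\neq0$). Let the truncation error in $I_j$ be $$-\frac{\hat f_{j+1/2}-\hat f_{j-1/2}}{\Delta x}+\frac{f(u(x_{j+1/2}))-f(u(x_{j-1/2}))}{\Delta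 x},$$ computed from the exact cell averages of $u$. Then MOP-WENO-X achieves the optimal order of accuracy at these cells under exactly the same conditions as WENO-X: 1. the truncation error of MOP-WENO-X in $I_{j(N)}$ is $O(\Delta x^{2r-1})$ if and only if that of WENO-X is; 2. more generally, for every real $p$, the one is $O(\Delta x^p)$ if and only if the other is; 3. for every real $p$ and every $s$, $\omega_s^{MOP\text{-}X}-d_s=O(\Delta x^p)$ if and only if $\omega_s^{X}-d_s=O(\Delta x^p)$, both for the weights of the left-biased and for those of the mirrored reconstruction on the stencil around $I_{j(N)}$. -/

import Mathlib

open Filter Topology Asymptotics Polynomial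
open scoped ContDiff

noncomputable section

namespace WENO

/-! ### Reconstruction on a stencil

The `(2r-1)`-point global stencil around a cell `I_j` is `I_{j-(r-1)}, …, I_{j+(r-1)}`.  Its cells are
numbered `0, …, 2r-2` from left to right, and `v i` is the cell average on cell number `i`.  In the
scaled coordinate used below, cell number `i` is `[i, i+1]`; so the central cell `I_j` is `[r-1, r]` and
its right boundary `x_{j+1/2}` is the point `r`.  The `s`-th substencil consists of the `r` cells
`s, …, s+r-1`. -/

/-- Sums of the cell averages: the values at the cell boundaries of a primitive function. -/
def primitive (v : ℕ → ℝ) (t : ℕ) : ℝ := ∑ i ∈ Finset.range t, v i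

/-- The polynomial of degree at most `m - 1` whose average on each of the `m` cells
`a, …, a + m - 1` is the given one: the derivative of the polynomial that interpolates the primitive
at the `m + 1` boundaries of these cells. -/
def reconPoly (a m : ℕ) (v : ℕ → ℝ) : ℝ[X] :=
  derivative (Lagrange.interpolate (Finset.Icc a (a + m)) (fun t : ℕ => (t : ℝ)) (primitive v))

/-- The `r`-th order approximation `u^s_{j+1/2}` of the value at `x_{j+1/2}` from substencil `s`. -/
def subRecon (r s : ℕ) (v : ℕ → ℝ) : ℝ := (reconPoly s r v).eval (r : ℝ)

/-- The central upstream approximation of order `2r-1`, from the whole stencil. -/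
def fullRecon (r : ℕ) (v : ℕ → ℝ) : ℝ := (reconPoly 0 (2 * r - 1) v).eval (r : ℝ)

/-- The ideal weights `d_0, …, d_{r-1}`; `sum_idealWeight_mul_subRecon` below shows that they
generate the central upstream scheme of order `2r-1` from the substencil approximations. -/
def idealWeight (r : ℕ) (s : Fin r) : ℝ :=
  ((r.choose s : ℝ) * ((r - 1).choose s : ℝ)) / ((2 * r - 1).choose r : ℝ)

/-! ### The reconstruction polynomials and the ideal weights are the standard ones -/

theorem injOn_cast (S : Set ℕ) : Set.InjOn (fun t : ℕ => (t : ℝ)) S :=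
  fun _ _ _ _ h => Nat.cast_injective (R := ℝ) h

/-- The average of `reconPoly a m v` on each cell `i` of the stencil is `v i`. -/
theorem integral_reconPoly (a m i : ℕ) (hi : a ≤ i) (hi' : i < a + m) (v : ℕ → ℝ) :
    ∫ τ in (i : ℝ)..((i + 1 : ℕ) : ℝ), (reconPoly a m v).eval τ = v i := by
  unfold reconPoly
  set p := Lagrange.interpolate (Finset.Icc a (a + m)) (fun t : ℕ => (t : ℝ)) (primitive v) with hp
  rw [intervalIntegral.integral_eq_sub_of_hasDerivAt (f := fun τ => p.eval τ)
    (fun τ _ => p.hasDerivAt τ)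
    ((derivative p).continuous.intervalIntegrable _ _)]
  have h1 : ∀ t ∈ Finset.Icc a (a + m), p.eval (t : ℝ) = primitive v t := fun t ht =>
    Lagrange.eval_interpolate_at_node (v := fun t : ℕ => (t : ℝ)) (primitive v) (injOn_cast _) ht
  rw [h1 i (by simp; omega), h1 (i + 1) (by simp; omega)]
  simp [primitive, Finset.sum_range_succ]

theorem prod_node_sub (a i m : ℕ) :
    ∏ q ∈ (Finset.Icc a (a + (i + m))).erase (a + i), (((a + i : ℕ) : ℝ) - (q : ℝ)) =
      (i.factorial : ℝ) * ((-1) ^ m * (m.factorial : ℝ)) := by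
  have hS : (Finset.Icc a (a + (i + m))).erase (a + i) =
      (Finset.range i).image (fun t => a + (i - 1 - t)) ∪
        (Finset.range m).image (fun t => a + i + 1 + t) := by
    ext q
    simp only [Finset.mem_erase, Finset.mem_Icc, Finset.mem_union, Finset.mem_image,
      Finset.mem_range]
    constructor
    · rintro ⟨h1, h2, h3⟩
      rcases lt_or_gt_of_ne h1 with h | h
      · exact Or.inl ⟨a + i - 1 - q, by omega, by omega⟩
      · exact Or.inr ⟨q - (a + i + 1), by omega, by omega⟩
    · rintro (⟨t, h1, h2⟩ | ⟨t, h1, h2⟩) <;> omega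
  rw [hS, Finset.prod_union, Finset.prod_image, Finset.prod_image]
  · congr 1
    · rw [← Finset.prod_range_add_one_eq_factorial]
      push_cast
      refine Finset.prod_congr rfl fun t ht => ?_
      have : t < i := Finset.mem_range.1 ht
      obtain ⟨e, rfl⟩ : ∃ e, i = t + 1 + e := ⟨i - (t + 1), by omega⟩
      have : t + 1 + e - 1 - t = e := by omega
      rw [this]; push_cast; ring
    · rw [← Finset.prod_range_add_one_eq_factorial]
      push_cast
      have : ((-1 : ℝ)) ^ m = ∏ _t ∈ Finset.range m, (-1 : ℝ) := by simp
      rw [this, ← Finset.prod_mul_distrib]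
      refine Finset.prod_congr rfl fun t ht => ?_
      ring
  · intro x _ y _ h
    simpa using h
  · intro x hx y hy h
    simp at hx hy h
    omega
  · rw [Finset.disjoint_left]
    simp only [Finset.mem_image, Finset.mem_range]
    rintro q ⟨t, h1, h2⟩ ⟨t', h3, h4⟩
    omega

theorem eval_derivative_basis (a m r k : ℕ) (hr : a ≤ r) (hr' : r ≤ a + m) (hk : a ≤ k)
    (hk' : k ≤ a + m) (hkr : k ≠ r) :
    (derivative (Lagrange.basis (Finset.Icc a (a + m)) (fun t : ℕ => (t : ℝ)) k)).eval (r : ℝ) =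
      ((r - a).factorial * (a + m - r).factorial : ℝ) / ((k - a).factorial * (a + m - k).factorial) *
        ((-1) ^ (k + r) / ((r : ℝ) - k)) := by
  have hkS : k ∈ Finset.Icc a (a + m) := by simp; omega
  have hrS : r ∈ (Finset.Icc a (a + m)).erase k := by simp; omega
  have hrS' : r ∈ Finset.Icc a (a + m) := by simp; omega
  have hkS' : k ∈ (Finset.Icc a (a + m)).erase r := by simp; omega
  have hne : (r : ℝ) - k ≠ 0 := by
    rw [sub_ne_zero]; exact_mod_cast hkr.symm
  rw [Lagrange.basis_eq_prod_sub_inv_mul_nodal_div hkS, ← Lagrange.nodal_erase_eq_nodal_div hkS,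
    derivative_C_mul, eval_C_mul]
  have := Lagrange.eval_nodal_derivative_eval_node_eq (v := fun t : ℕ => (t : ℝ)) hrS
  rw [this, Lagrange.eval_nodal, Lagrange.nodalWeight_eq_eval_nodal_erase_inv, Lagrange.eval_nodal]
  have e1 := prod_node_sub a (k - a) (a + m - k)
  have e2 := prod_node_sub a (r - a) (a + m - r)
  rw [show a + (k - a + (a + m - k)) = a + m by omega, show a + (k - a) = k by omega] at e1
  rw [show a + (r - a + (a + m - r)) = a + m by omega, show a + (r - a) = r by omega,
    ← Finset.mul_prod_erase _ _ hkS', Finset.erase_right_comm] at e2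
  rw [e1, eq_div_of_mul_eq hne ((mul_comm _ _).trans e2)]
  have f1 : ((k - a).factorial : ℝ) ≠ 0 := by positivity
  have f2 : ((a + m - k).factorial : ℝ) ≠ 0 := by positivity
  have s1 : ((-1 : ℝ)) ^ (a + m - r) = (-1) ^ (a + m - k) * (-1) ^ (k + r) := by
    rw [← pow_add, show a + m - k + (k + r) = (a + m - r) + 2 * r by omega, pow_add, pow_mul]
    simp
  have s2 : ((-1 : ℝ)) ^ (a + m - k) ≠ 0 := by positivity
  rw [s1]
  field_simp

theorem eval_reconPoly (a m r : ℕ) (hr : a ≤ r) (hr' : r ≤ a + m) (v : ℕ → ℝ) :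
    (reconPoly a m v).eval (r : ℝ) =
      ∑ k ∈ (Finset.Icc a (a + m)).erase r, (primitive v k - primitive v r) *
        (((r - a).factorial * (a + m - r).factorial : ℝ) /
          ((k - a).factorial * (a + m - k).factorial) * ((-1) ^ (k + r) / ((r : ℝ) - k))) := by
  have hrS : r ∈ Finset.Icc a (a + m) := by simp; omega
  have h0 : Lagrange.interpolate (Finset.Icc a (a + m)) (fun t : ℕ => (t : ℝ)) (primitive v) =
      Lagrange.interpolate (Finset.Icc a (a + m)) (fun t : ℕ => (t : ℝ))
        (fun k => primitive v k - primitive v r) + C (primitive v r) := by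
    have h1 : primitive v =
        (fun k => primitive v k - primitive v r) + (primitive v r) • (1 : ℕ → ℝ) := by
      ext k; simp
    conv_lhs => rw [h1]
    rw [map_add, map_smul, Lagrange.interpolate_one (injOn_cast _) ⟨r, hrS⟩, smul_eq_C_mul, mul_one]
  unfold reconPoly
  rw [h0, derivative_add, derivative_C, add_zero, Lagrange.interpolate_apply, derivative_sum,
    eval_finsetSum, ← Finset.add_sum_erase _ _ hrS]
  simp only [derivative_C_mul, eval_C_mul, sub_self, zero_mul, zero_add]
  refine Finset.sum_congr rfl fun k hk => ?_
  simp only [Finset.mem_erase, Finset.mem_Icc] at hk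
  rw [eval_derivative_basis a m r k hr hr' hk.2.1 hk.2.2 hk.1]

/-- The ideal weights generate the central upstream approximation of order `2r-1`. -/
theorem sum_idealWeight_mul_subRecon (r : ℕ) (hr : 1 ≤ r) (v : ℕ → ℝ) :
    ∑ s : Fin r, idealWeight r s * subRecon r s v = fullRecon r v := by
  unfold subRecon fullRecon
  rw [eval_reconPoly 0 (2 * r - 1) r (by omega) (by omega)]
  have hs : ∀ s : Fin r, (reconPoly s r v).eval (r : ℝ) =
      ∑ k ∈ (Finset.Icc 0 (0 + (2 * r - 1))).erase r, if (s : ℕ) ≤ k ∧ k ≤ s + r then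
        (primitive v k - primitive v r) *
        (((r - s).factorial * (s + r - r).factorial : ℝ) /
          ((k - s).factorial * (s + r - k).factorial) * ((-1) ^ (k + r) / ((r : ℝ) - k)))
        else 0 := by
    intro s
    have := s.2
    rw [eval_reconPoly s r r (by omega) (by omega), ← Finset.sum_filter]
    refine Finset.sum_congr ?_ fun _ _ => rfl
    ext k
    simp only [Finset.mem_erase, Finset.mem_Icc, Finset.mem_filter]
    omega
  simp only [hs, Finset.mul_sum]
  rw [Finset.sum_comm]
  refine Finset.sum_congr rfl fun k hk => ?_
  simp only [Finset.mem_erase, Finset.mem_Icc] at hk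
  obtain ⟨hkr, -, hk2⟩ := hk
  have key : ∑ s : Fin r, (r - 1).choose s * (if (s : ℕ) ≤ k then r.choose (k - s) else 0) =
      (2 * r - 1).choose k := by
    rw [show 2 * r - 1 = (r - 1) + r by omega, Nat.add_choose_eq,
      Finset.Nat.sum_antidiagonal_eq_sum_range_succ
        (f := fun i l => (r - 1).choose i * r.choose l),
      Fin.sum_univ_eq_sum_range
        (fun s => (r - 1).choose s * (if s ≤ k then r.choose (k - s) else 0)) r]
    have h1 : ∀ n, r ≤ n → k < n →
        ∑ s ∈ Finset.range n, (r - 1).choose s * (if s ≤ k then r.choose (k - s) else 0) =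
        ∑ s ∈ Finset.range r, (r - 1).choose s * (if s ≤ k then r.choose (k - s) else 0) := by
      intro n hn _
      symm
      refine Finset.sum_subset (Finset.range_mono hn) fun s _ h => ?_
      rw [Nat.choose_eq_zero_of_lt (by simp at h; omega), zero_mul]
    rw [← h1 (r + k + 1) (by omega) (by omega)]
    symm
    have h2 : Finset.range k.succ ⊆ Finset.range (r + k + 1) :=
      Finset.range_mono (by omega)
    rw [← Finset.sum_subset h2]
    · refine Finset.sum_congr rfl fun s hs => ?_
      rw [if_pos (by simp at hs; omega)]
    · intro s _ h
      rw [if_neg (by simp at h; omega), mul_zero]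
  have hD : ((2 * r - 1).choose r : ℝ) ≠ 0 := by
    have := Nat.choose_pos (show r ≤ 2 * r - 1 by omega)
    positivity
  have hfull : (((r - 0).factorial : ℝ) * (0 + (2 * r - 1) - r).factorial) /
      ((k - 0).factorial * (0 + (2 * r - 1) - k).factorial) =
      ((2 * r - 1).choose k : ℝ) / (2 * r - 1).choose r := by
    rw [Nat.cast_choose ℝ (show k ≤ 2 * r - 1 by omega),
      Nat.cast_choose ℝ (show r ≤ 2 * r - 1 by omega)]
    simp only [Nat.sub_zero, zero_add]
    field_simp
  rw [hfull, ← key]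
  push_cast
  rw [Finset.sum_div, Finset.sum_mul, Finset.mul_sum]
  refine Finset.sum_congr rfl fun s _ => ?_
  have hs := s.2
  unfold idealWeight
  by_cases h1 : (s : ℕ) ≤ k
  · by_cases h2 : k ≤ s + r
    · rw [if_pos ⟨h1, h2⟩, if_pos h1, Nat.cast_choose ℝ (show (s : ℕ) ≤ r by omega),
        Nat.cast_choose ℝ (show k - s ≤ r by omega), show (s : ℕ) + r - r = s by omega,
        show r - (k - s) = s + r - k by omega]
      field_simp
    · rw [if_neg (by omega), if_pos h1, Nat.choose_eq_zero_of_lt (show r < k - s by omega)]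
      simp
  · rw [if_neg (by omega), if_neg h1]
    simp

/-! ### Smoothness indicators -/

/-- The smoothness indicator of Jiang and Shu,
`β_s = ∑_{l=1}^{r-1} Δx^{2l-1} ∫_{I_j} (d^l p_s / dx^l)^2 dx`, written in the scaled coordinate. -/
def smoothness (r s : ℕ) (v : ℕ → ℝ) : ℝ :=
  ∑ l ∈ Finset.Icc 1 (r - 1),
    ∫ τ in ((r : ℝ) - 1)..(r : ℝ), ((derivative^[l] (reconPoly s r v)).eval τ) ^ 2

/-! ### Nonlinear weights -/

/-- `ω_s = α_s / ∑_l α_l`. -/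
def normalize {r : ℕ} (α : Fin r → ℝ) (s : Fin r) : ℝ := α s / ∑ l, α l

/-- The weights `ω^{JS}_s` of the WENO-JS scheme. -/
def weightJS (r : ℕ) (ε : ℝ) (v : ℕ → ℝ) : Fin r → ℝ :=
  normalize (fun s => idealWeight r s / (ε + smoothness r s v) ^ 2)

/-- The weights of the WENO-X scheme.  Its mapping functions are
`g^X_s(ω) = g (P s) ω`, where `P s` is the list of the `mP` parameters attached to substencil `s`. -/
def weightX (r : ℕ) (ε : ℝ) {mP : ℕ} (g : (Fin mP → ℝ) → ℝ → ℝ) (P : Fin r → Fin mP → ℝ)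
    (v : ℕ → ℝ) : Fin r → ℝ :=
  normalize (fun s => g (P s) (weightJS r ε v s))

/-- The indices at which `|ω - d_0|, …, |ω - d_{r-1}|` is smallest. -/
def indexOfMin {r : ℕ} (d : Fin r → ℝ) (w : ℝ) : Finset (Fin r) :=
  Finset.univ.filter fun k => ∀ i, |w - d k| ≤ |w - d i|

theorem indexOfMin_nonempty {r : ℕ} [NeZero r] (d : Fin r → ℝ) (w : ℝ) :
    (indexOfMin d w).Nonempty := by
  obtain ⟨k, -, hk⟩ := Finset.exists_min_image Finset.univ (fun k => |w - d k|)
    ⟨(0 : Fin r), Finset.mem_univ _⟩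
  exact ⟨k, by simpa [indexOfMin] using hk⟩

/-- `minDist(x_0, …, x_{r-1}; d_0, …, d_{r-1}; ω) = x_{k*}`, where `k*` is the smallest index `k` at
which `|ω - d_k|` is minimal. -/
def minDist {r : ℕ} [NeZero r] {A : Type*} (x : Fin r → A) (d : Fin r → ℝ) (w : ℝ) : A :=
  x ((indexOfMin d w).min' (indexOfMin_nonempty d w))

/-- The weights of the MOP-WENO-X scheme: in the mapping function of each substencil `s`, the
parameters `P s` are replaced by the parameters `P k*` selected by `minDist` at `ω^{JS}_s`. -/
def weightMOP (r : ℕ) [NeZero r] (ε : ℝ) {mP : ℕ} (g : (Fin mP → ℝ) → ℝ → ℝ)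
    (P : Fin r → Fin mP → ℝ) (v : ℕ → ℝ) : Fin r → ℝ :=
  normalize (fun s =>
    g (minDist P (idealWeight r) (weightJS r ε v s)) (weightJS r ε v s))

/-! ### The semi-discrete finite volume scheme on a uniform mesh -/

/-- The mesh size of the mesh of `N` cells on `[xl, xr]`. -/
def meshSize (xl xr : ℝ) (N : ℕ) : ℝ := (xr - xl) / N

/-- The centre of cell `I_j`. -/
def cellCenter (xl xr : ℝ) (N : ℕ) (j : ℤ) : ℝ := xl + ((j : ℝ) - 1 / 2) * meshSize xl xr N

/-- The right boundary `x_{j+1/2}` of cell `I_j`. -/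
def cellRight (xl xr : ℝ) (N : ℕ) (j : ℤ) : ℝ := cellCenter xl xr N j + meshSize xl xr N / 2

/-- The average of `u` over cell `I_j`. -/
def cellAverage (u : ℝ → ℝ) (xl xr : ℝ) (N : ℕ) (j : ℤ) : ℝ :=
  (1 / meshSize xl xr N) * ∫ x in cellRight xl xr N (j - 1)..cellRight xl xr N j, u x

/-- The data on the global stencil around cell `I_j`, from left to right (used for `u^-_{j+1/2}`). -/
def stencil (r : ℕ) (a : ℤ → ℝ) (j : ℤ) (i : ℕ) : ℝ := a (j - ((r : ℤ) - 1) + i)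

/-- The data on the global stencil around cell `I_j`, from right to left (used for `u^+_{j-1/2}`). -/
def mirrorStencil (r : ℕ) (a : ℤ → ℝ) (j : ℤ) (i : ℕ) : ℝ := a (j + ((r : ℤ) - 1) - i)

/-- The WENO reconstruction `∑_s ω_s u^s_{j+1/2}` with weights given by `W`. -/
def weno (r : ℕ) (W : (ℕ → ℝ) → Fin r → ℝ) (v : ℕ → ℝ) : ℝ := ∑ s : Fin r, W v s * subRecon r s v

/-- `u^-_{j+1/2}`. -/
def uMinus (r : ℕ) (W : (ℕ → ℝ) → Fin r → ℝ) (a : ℤ → ℝ) (j : ℤ) : ℝ := weno r W (stencil r a j)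

/-- `u^+_{j+1/2}`, by mirror symmetry with respect to `x_{j+1/2}`. -/
def uPlus (r : ℕ) (W : (ℕ → ℝ) → Fin r → ℝ) (a : ℤ → ℝ) (j : ℤ) : ℝ :=
  weno r W (mirrorStencil r a (j + 1))

/-- The Lax-Friedrichs flux with constant `α`. -/
def laxFriedrichs (f : ℝ → ℝ) (α a b : ℝ) : ℝ := (1 / 2) * (f a + f b - α * (b - a))

/-- The numerical flux at `x_{j+1/2}`. -/
def numFlux (r : ℕ) (W : (ℕ → ℝ) → Fin r → ℝ) (f : ℝ → ℝ) (α : ℝ) (a : ℤ → ℝ) (j : ℤ) : ℝ :=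
  laxFriedrichs f α (uMinus r W a j) (uPlus r W a j)

/-- The spatial operator of the semi-discrete scheme `d a_j / dt = L(a)_j`. -/
def spatialOp (r : ℕ) (W : (ℕ → ℝ) → Fin r → ℝ) (f : ℝ → ℝ) (α h : ℝ) (a : ℤ → ℝ) (j : ℤ) : ℝ :=
  -(1 / h) * (numFlux r W f α a j - numFlux r W f α a (j - 1))

/-- The truncation error in cell `I_j`: the spatial operator at the exact cell averages of `u`, minus
the exact rate of change `-(f(u(x_{j+1/2})) - f(u(x_{j-1/2}))) / Δx` of the cell average. -/
def truncationError (r : ℕ) (W : (ℕ → ℝ) → Fin r → ℝ) (f : ℝ → ℝ) (α : ℝ) (u : ℝ → ℝ)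
    (xl xr : ℝ) (N : ℕ) (j : ℤ) : ℝ :=
  spatialOp r W f α (meshSize xl xr N) (cellAverage u xl xr N) j -
    (-(1 / meshSize xl xr N) *
      (f (u (cellRight xl xr N j)) - f (u (cellRight xl xr N (j - 1)))))

/-- The truncation error in the cells `I_{j N}` is `O(Δx^p)` as the mesh is refined. -/
def HasOrder (r : ℕ) (W : (ℕ → ℝ) → Fin r → ℝ) (f : ℝ → ℝ) (α : ℝ) (u : ℝ → ℝ)
    (xl xr : ℝ) (j : ℕ → ℤ) (p : ℝ) : Prop :=
  (fun N => truncationError r W f α u xl xr N (j N)) =O[atTop] fun N => meshSize xl xr N ^ p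

/-- The optimal order of a `(2r-1)`th-order scheme. -/
def HasOptimalOrder (r : ℕ) (W : (ℕ → ℝ) → Fin r → ℝ) (f : ℝ → ℝ) (α : ℝ) (u : ℝ → ℝ)
    (xl xr : ℝ) (j : ℕ → ℤ) : Prop :=
  HasOrder r W f α u xl xr j (2 * r - 1)

/-- `n` is the order `n_cp` of the critical point `x` of `u` (`0` for a non-critical point). -/
def HasCriticalOrder (u : ℝ → ℝ) (x : ℝ) (n : ℕ) : Prop :=
  (∀ k, 1 ≤ k → k ≤ n → iteratedDeriv k u x = 0) ∧ iteratedDeriv (n + 1) u x ≠ 0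

end WENO

end

noncomputable section

namespace WENO

/-! ### The ideal weights are distinct and sum to one -/

/-! For all large `N` the two schemes use identical weights on every stencil that enters the
truncation error, so errors and weights are eventually equal, not merely of the same order. Indeed
the JS weights `ω_s` tend to `d_s` along stencils that shrink to `x₀`, and the `d_s` are pairwise
distinct (`idealWeight_injective`). Hence `d_s` is eventually the only ideal weight nearest to
`ω_s`, and the selected index is `s` (`eventually_minDist_eq`). No property of the mapping functions
is needed, not even continuity.

The convergence (`tendsto_weightJS`) holds because the `ε + β_s` are asymptotic to one quantity
independent of `s`, which cancels in the normalization. For `ε > 0` this quantity is `ε`, since `β_s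
→ 0`. For `ε = 0`, `β_s` is a quadratic energy of the reconstruction polynomial in the scaled
coordinate. Every substencil reproduces the same Taylor polynomial of degree `r - 1`, expanded at
the edge of the global stencil; the remainder data are `O(Δx^r)` and contribute energy `O(Δx^(2r))`.
A nonzero derivative of order `n + 1 ≤ r - 1` keeps the Taylor energy above a positive multiple of
`Δx^(2(r-1))`, so the remainder is relatively `O(Δx²)` (`exists_tendsto_smoothness_div`). That lower
bound comes from `abs_eval_iterate_derivative_le`: the energy controls the derivatives of the
polynomial. -/

theorem ascFactorial_strictMono {k : ℕ} (hk : k ≠ 0) : StrictMono fun n : ℕ => n.ascFactorial k := by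
  refine strictMono_nat_of_lt_succ fun n => ?_
  obtain ⟨l, rfl⟩ := Nat.exists_eq_succ_of_ne_zero hk
  have h1 : n.ascFactorial (l + 1) = n * (n + 1).ascFactorial l := by
    have := Nat.ascFactorial_mul_ascFactorial n 1 l
    rw [add_comm l 1, ← this]
    simp [Nat.ascFactorial_succ]
  have h2 : (n + 1).ascFactorial (l + 1) = (n + 1 + l) * (n + 1).ascFactorial l :=
    Nat.ascFactorial_succ
  have h3 : 0 < (n + 1).ascFactorial l := Nat.ascFactorial_pos n l
  show n.ascFactorial (l + 1) < (n + 1).ascFactorial (l + 1)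
  rw [h1, h2]
  exact Nat.mul_lt_mul_of_pos_right (by omega) h3

/-- With `r = s + k + b + 1`, equality of the weights at `s` and `s + k` reduces, after clearing
factorials, to an equality between the product of the rising factorials of length `k` from `b + 1`
and from `b + 2` and the square of the one from `s + 1`. These are strictly increasing in the
starting point, and no `s + 1` lies strictly between two consecutive integers. -/
theorem choose_mul_choose_ne (s k b : ℕ) (hk : k ≠ 0) :
    (s + k + (b + 1)).choose s * (s + k + b).choose s ≠
      (s + k + (b + 1)).choose (s + k) * (s + k + b).choose (s + k) := by
  intro h
  have e1 : (s + k + (b + 1)).choose s * s.factorial * (b + 1 + k).factorial =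
      (s + k + (b + 1)).factorial := by
    have := Nat.choose_mul_factorial_mul_factorial (show s ≤ s + k + (b + 1) by omega)
    rwa [show s + k + (b + 1) - s = b + 1 + k by omega] at this
  have e2 : (s + k + b).choose s * s.factorial * (b + k).factorial = (s + k + b).factorial := by
    have := Nat.choose_mul_factorial_mul_factorial (show s ≤ s + k + b by omega)
    rwa [show s + k + b - s = b + k by omega] at this
  have e3 : (s + k + (b + 1)).choose (s + k) * (s + k).factorial * (b + 1).factorial =
      (s + k + (b + 1)).factorial := by
    have := Nat.choose_mul_factorial_mul_factorial (show s + k ≤ s + k + (b + 1) by omega)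
    rwa [show s + k + (b + 1) - (s + k) = b + 1 by omega] at this
  have e4 : (s + k + b).choose (s + k) * (s + k).factorial * b.factorial =
      (s + k + b).factorial := by
    have := Nat.choose_mul_factorial_mul_factorial (show s + k ≤ s + k + b by omega)
    rwa [show s + k + b - (s + k) = b by omega] at this
  rw [← Nat.factorial_mul_ascFactorial] at e1 e2
  rw [← Nat.factorial_mul_ascFactorial s k] at e3 e4
  have c1 : 0 < (s + k + (b + 1)).choose s * (s + k + b).choose s :=
    Nat.mul_pos (Nat.choose_pos (by omega)) (Nat.choose_pos (by omega))
  have key : (b + 1).ascFactorial k * (b + 1 + 1).ascFactorial k =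
      (s + 1).ascFactorial k * (s + 1).ascFactorial k := by
    have hs := Nat.factorial_pos s
    have hb := Nat.factorial_pos b
    have hb' := Nat.factorial_pos (b + 1)
    have : (((s + k + (b + 1)).choose s * (s + k + b).choose s) *
        (s.factorial * s.factorial * b.factorial * (b + 1).factorial)) *
          ((b + 1).ascFactorial k * (b + 1 + 1).ascFactorial k) =
        (((s + k + (b + 1)).choose s * (s + k + b).choose s) *
        (s.factorial * s.factorial * b.factorial * (b + 1).factorial)) *
          ((s + 1).ascFactorial k * (s + 1).ascFactorial k) := by
      have e13 := e1.trans e3.symm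
      have e24 := e2.trans e4.symm
      have := congrArg₂ (· * ·) e13 e24
      calc _ = (s + k + (b + 1)).choose s * s.factorial *
            ((b + 1).factorial * (b + 1 + 1).ascFactorial k) *
            ((s + k + b).choose s * s.factorial * (b.factorial * (b + 1).ascFactorial k)) := by ring
        _ = _ := this
        _ = ((s + k + (b + 1)).choose (s + k) * (s + k + b).choose (s + k)) *
              (s.factorial * s.factorial * b.factorial * (b + 1).factorial) *
              ((s + 1).ascFactorial k * (s + 1).ascFactorial k) := by ring
        _ = _ := by rw [h]
    exact Nat.eq_of_mul_eq_mul_left (by positivity) this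
  have mono := ascFactorial_strictMono hk
  have pos : 0 < (s + 1).ascFactorial k := Nat.ascFactorial_pos s k
  rcases le_or_gt (s + 1) (b + 1) with hsb | hsb
  · have h1 : (s + 1).ascFactorial k ≤ (b + 1).ascFactorial k := mono.monotone hsb
    have h2 : (s + 1).ascFactorial k < (b + 1 + 1).ascFactorial k := mono (by omega)
    have := Nat.mul_lt_mul_of_le_of_lt h1 h2 (by omega)
    omega
  · have h1 : (b + 1).ascFactorial k < (s + 1).ascFactorial k := mono hsb
    have h2 : (b + 1 + 1).ascFactorial k ≤ (s + 1).ascFactorial k := mono.monotone hsb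
    have := Nat.mul_lt_mul_of_lt_of_le h1 h2 pos
    omega

theorem idealWeight_injective (r : ℕ) : Function.Injective (idealWeight r) := by
  have hne : ∀ s t : Fin r, s < t → idealWeight r s ≠ idealWeight r t := by
    intro s t hst h
    have ht := t.2
    have hst' : (s : ℕ) < t := hst
    have hD : ((2 * r - 1).choose r : ℝ) ≠ 0 := by
      have := Nat.choose_pos (show r ≤ 2 * r - 1 by omega)
      positivity
    unfold idealWeight at h
    rw [div_left_inj' hD] at h
    norm_cast at h
    have := choose_mul_choose_ne s (t - s) (r - 1 - t) (by omega)
    rw [show (s : ℕ) + (t - s) = t by omega, show (t : ℕ) + (r - 1 - t + 1) = r by omega,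
      show (t : ℕ) + (r - 1 - t) = r - 1 by omega] at this
    exact this h
  intro s t h
  rcases lt_trichotomy s t with hst | hst | hst
  · exact absurd h (hne s t hst)
  · exact hst
  · exact absurd h.symm (hne t s hst)

/-! ### Linearity and exactness of the reconstruction -/

theorem primitive_add (v w : ℕ → ℝ) : primitive (v + w) = primitive v + primitive w := by
  ext t; simp [primitive, Finset.sum_add_distrib]

theorem primitive_smul (c : ℝ) (v : ℕ → ℝ) : primitive (c • v) = c • primitive v := by
  ext t; simp [primitive, Finset.mul_sum]

/-- `reconPoly` as a linear map in the cell averages. -/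
def reconLinear (a m : ℕ) : (ℕ → ℝ) →ₗ[ℝ] ℝ[X] where
  toFun := reconPoly a m
  map_add' v w := by simp only [reconPoly, primitive_add, map_add]
  map_smul' c v := by simp [reconPoly, primitive_smul, smul_eq_C_mul]

theorem reconLinear_apply (a m : ℕ) (v : ℕ → ℝ) : reconLinear a m v = reconPoly a m v := rfl

theorem reconPoly_congr (a m : ℕ) {v w : ℕ → ℝ} (h : ∀ i < a + m, v i = w i) :
    reconPoly a m v = reconPoly a m w := by
  unfold reconPoly
  congr 1
  refine Lagrange.interpolate_eq_of_values_eq_on _ _ fun t ht => ?_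
  refine Finset.sum_congr rfl fun i hi => h i ?_
  simp at ht hi
  omega

theorem reconPoly_eq_sum (a m : ℕ) (v : ℕ → ℝ) :
    reconPoly a m v = ∑ i ∈ Finset.range (a + m), v i • reconPoly a m (Pi.single i 1) := by
  rw [reconPoly_congr a m (w := ∑ i ∈ Finset.range (a + m), v i • Pi.single i (1 : ℝ))]
  · simp only [← reconLinear_apply, map_sum, map_smul]
  · intro i hi
    simp [Finset.sum_apply, Pi.single_apply, hi]

/-- The reconstruction is exact for polynomials of degree below `m`, here the derivatives of
polynomials of degree at most `m`. -/
theorem reconPoly_eval_sub (a m : ℕ) (Q : ℝ[X]) (hQ : Q.natDegree ≤ m) :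
    reconPoly a m (fun i => Q.eval ((i + 1 : ℕ) : ℝ) - Q.eval (i : ℝ)) = derivative Q := by
  unfold reconPoly
  -- The partial sums telescope to `Q - Q(0)`, of degree at most `m`, which its values at the `m +
  -- 1` nodes determine.
  rw [← Lagrange.eq_interpolate_of_eval_eq (f := Q - C (Q.eval 0)) _ (injOn_cast _)]
  · simp
  · refine lt_of_le_of_lt (degree_le_natDegree) ?_
    have := natDegree_sub_C (p := Q) (a := Q.eval 0)
    rw [this]
    simp only [Nat.card_Icc]
    exact_mod_cast (by omega : Q.natDegree < a + m + 1 - a)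
  · intro t _
    have := Finset.sum_range_sub (fun i : ℕ => Q.eval (i : ℝ)) t
    simp [primitive] at this ⊢
    rw [this]

theorem reconPoly_const (a m : ℕ) (hm : 1 ≤ m) (c : ℝ) : reconPoly a m (fun _ => c) = C c := by
  have := reconPoly_eval_sub a m (C c * X) ((natDegree_C_mul_le _ _).trans (by simpa using hm))
  simp only [derivative_C_mul, derivative_X, mul_one] at this
  rw [← this]
  refine reconPoly_congr a m fun i _ => ?_
  simp
  ring

/-- On the constant data `1` every reconstruction returns `1`, so the identity that defines the
ideal weights becomes their sum. -/
theorem sum_idealWeight (r : ℕ) (hr : 1 ≤ r) : ∑ s : Fin r, idealWeight r s = 1 := by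
  have := sum_idealWeight_mul_subRecon r hr (fun _ => 1)
  simpa [subRecon, fullRecon, reconPoly_const _ r hr, reconPoly_const 0 (2 * r - 1) (by omega)]
    using this

/-! ### The smoothness energy of a polynomial -/

/-- The sum of the squared `L²`-norms over the central cell of the derivatives of orders
`1, …, r - 1`. -/
def energy (r : ℕ) (p : ℝ[X]) : ℝ :=
  ∑ l ∈ Finset.Icc 1 (r - 1), ∫ τ in ((r : ℝ) - 1)..(r : ℝ), ((derivative^[l] p).eval τ) ^ 2

theorem smoothness_eq_energy (r s : ℕ) (v : ℕ → ℝ) :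
    smoothness r s v = energy r (reconPoly s r v) := rfl

theorem intervalIntegrable_eval_sq (p : ℝ[X]) (a b : ℝ) :
    IntervalIntegrable (fun τ => p.eval τ ^ 2) MeasureTheory.volume a b :=
  (p.continuous.pow 2).intervalIntegrable _ _

theorem energy_nonneg (r : ℕ) (p : ℝ[X]) : 0 ≤ energy r p :=
  Finset.sum_nonneg fun _ _ =>
    intervalIntegral.integral_nonneg (by linarith) fun _ _ => sq_nonneg _

theorem energy_neg (r : ℕ) (p : ℝ[X]) : energy r (-p) = energy r p := by
  simp [energy]

theorem energy_add_C (r : ℕ) (p : ℝ[X]) (c : ℝ) : energy r (p + C c) = energy r p := by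
  refine Finset.sum_congr rfl fun l hl => ?_
  obtain ⟨k, rfl⟩ : ∃ k, l = k + 1 := ⟨l - 1, by simp at hl; omega⟩
  simp [Function.iterate_succ_apply]

/-- Young's inequality under the integral. The free parameter `η` keeps the leading constant
arbitrarily close to `1`, which an asymptotic equivalence needs. -/
theorem energy_add_le (r : ℕ) (p q : ℝ[X]) {η : ℝ} (hη : 0 < η) :
    energy r (p + q) ≤ (1 + η) * energy r p + (1 + 1 / η) * energy r q := by
  unfold energy
  rw [Finset.mul_sum, Finset.mul_sum, ← Finset.sum_add_distrib]
  refine Finset.sum_le_sum fun l _ => ?_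
  rw [← intervalIntegral.integral_const_mul, ← intervalIntegral.integral_const_mul,
    ← intervalIntegral.integral_add ((intervalIntegrable_eval_sq _ _ _).const_mul _)
      ((intervalIntegrable_eval_sq _ _ _).const_mul _)]
  refine intervalIntegral.integral_mono (by linarith) (intervalIntegrable_eval_sq _ _ _)
    (((intervalIntegrable_eval_sq _ _ _).const_mul _).add
      ((intervalIntegrable_eval_sq _ _ _).const_mul _)) fun τ => ?_
  simp only [iterate_map_add, eval_add]
  set x := eval τ (derivative^[l] p)
  set y := eval τ (derivative^[l] q)
  have h : 0 ≤ (η * x - y) ^ 2 / η := by positivity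
  have h' : (η * x - y) ^ 2 / η = η * x ^ 2 - 2 * (x * y) + 1 / η * y ^ 2 := by
    field_simp
    ring
  nlinarith

theorem energy_sum_smul_le (r : ℕ) {ι : Type*} (S : Finset ι) (c : ι → ℝ) (B : ι → ℝ[X]) :
    energy r (∑ i ∈ S, c i • B i) ≤ S.card * ∑ i ∈ S, c i ^ 2 * energy r (B i) := by
  have hint : ∀ (l : ℕ) (i : ι), IntervalIntegrable
      (fun τ => c i ^ 2 * (derivative^[l] (B i)).eval τ ^ 2) MeasureTheory.volume
      ((r : ℝ) - 1) r := fun l i => (intervalIntegrable_eval_sq _ _ _).const_mul _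
  unfold energy
  simp only [Finset.mul_sum]
  rw [Finset.sum_comm]
  refine Finset.sum_le_sum fun l _ => ?_
  rw [← Finset.mul_sum]
  simp only [← intervalIntegral.integral_const_mul]
  rw [← intervalIntegral.integral_finsetSum fun i _ => hint l i,
    ← intervalIntegral.integral_const_mul]
  refine intervalIntegral.integral_mono (by linarith) (intervalIntegrable_eval_sq _ _ _)
    (Continuous.intervalIntegrable (by fun_prop) _ _) fun τ => ?_
  simp only [iterate_derivative_sum, iterate_derivative_smul, eval_finsetSum, eval_smul,
    smul_eq_mul, ← mul_pow]
  exact sq_sum_le_card_mul_sum_sq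

/-- The energy of a reconstruction is bounded by the squares of its data. -/
theorem exists_energy_reconPoly_le (r s : ℕ) : ∃ K : ℝ, 0 ≤ K ∧ ∀ (v : ℕ → ℝ) (δ : ℝ),
    (∀ i < s + r, |v i| ≤ δ) → energy r (reconPoly s r v) ≤ K * δ ^ 2 := by
  refine ⟨((s + r : ℕ) : ℝ) * ∑ i ∈ Finset.range (s + r), energy r (reconPoly s r (Pi.single i 1)),
    mul_nonneg (Nat.cast_nonneg _) (Finset.sum_nonneg fun _ _ => energy_nonneg _ _), ?_⟩
  intro v δ h
  rw [reconPoly_eq_sum]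
  refine (energy_sum_smul_le _ _ _ _).trans ?_
  rw [Finset.card_range, mul_assoc, Finset.sum_mul]
  refine mul_le_mul_of_nonneg_left (Finset.sum_le_sum fun i hi => ?_) (Nat.cast_nonneg _)
  rw [mul_comm]
  refine mul_le_mul_of_nonneg_left ?_ (energy_nonneg _ _)
  rw [← sq_abs]
  exact pow_le_pow_left₀ (abs_nonneg _) (h i (Finset.mem_range.1 hi)) 2

/-- Cauchy–Schwarz on the central cell, whose length is `1` in the scaled coordinate. -/
theorem abs_integral_iterate_derivative_le (r l : ℕ) (hl : 1 ≤ l) (hl' : l ≤ r - 1) (p : ℝ[X]) :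
    |∫ τ in ((r : ℝ) - 1)..(r : ℝ), (derivative^[l] p).eval τ| ≤ √(energy r p) := by
  refine Real.abs_le_sqrt ?_
  have hle : ∫ τ in ((r : ℝ) - 1)..(r : ℝ), ((derivative^[l] p).eval τ) ^ 2 ≤ energy r p :=
    Finset.single_le_sum (f := fun l => ∫ τ in ((r : ℝ) - 1)..(r : ℝ),
      ((derivative^[l] p).eval τ) ^ 2)
      (fun _ _ => intervalIntegral.integral_nonneg (by linarith) fun _ _ => sq_nonneg _)
      (Finset.mem_Icc.2 ⟨hl, hl'⟩)
  refine le_trans ?_ hle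
  set q := derivative^[l] p
  set m := ∫ τ in ((r : ℝ) - 1)..(r : ℝ), q.eval τ with hm
  -- The variance of `q` over the unit cell is nonnegative, and it equals the mean of `q²` minus
  -- `m²`.
  have h0 : 0 ≤ ∫ τ in ((r : ℝ) - 1)..(r : ℝ), ((q - C m).eval τ) ^ 2 :=
    intervalIntegral.integral_nonneg (by linarith) fun _ _ => sq_nonneg _
  have h1 : ∫ τ in ((r : ℝ) - 1)..(r : ℝ), ((q - C m).eval τ) ^ 2 =
      (∫ τ in ((r : ℝ) - 1)..(r : ℝ), q.eval τ ^ 2) - 2 * m * m + m ^ 2 := by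
    have : ∀ τ, ((q - C m).eval τ) ^ 2 = q.eval τ ^ 2 - 2 * m * q.eval τ + m ^ 2 := by
      intro τ; simp; ring
    simp only [this]
    rw [intervalIntegral.integral_add, intervalIntegral.integral_sub,
      intervalIntegral.integral_const_mul, ← hm]
    · simp
    · exact intervalIntegrable_eval_sq _ _ _
    all_goals exact Continuous.intervalIntegrable (by fun_prop) _ _
  nlinarith

/-- A polynomial of degree at most `d` is bounded on `[0, r]` if the means over the central cell of
all its derivatives are. -/
theorem abs_eval_le_of_abs_integral_le (r : ℕ) (hr : 1 ≤ r) {δ : ℝ} (d : ℕ) : ∀ (W : ℝ[X]),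
    W.natDegree ≤ d →
    (∀ m ≤ d, |∫ τ in ((r : ℝ) - 1)..(r : ℝ), (derivative^[m] W).eval τ| ≤ δ) →
    ∀ τ ∈ Set.Icc (0 : ℝ) r, |W.eval τ| ≤ (∑ m ∈ Finset.range (d + 1), (r : ℝ) ^ m) * δ := by
  have hr' : (1 : ℝ) ≤ r := by exact_mod_cast hr
  induction d with
  | zero =>
    intro W hW h τ _
    obtain ⟨c, rfl⟩ : ∃ c, W = C c := ⟨_, eq_C_of_natDegree_le_zero hW⟩
    simpa using h 0 le_rfl
  | succ d ih =>
    intro W hW h τ hτ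
    have hW' : (derivative W).natDegree ≤ d :=
      (natDegree_derivative_le W).trans (by omega)
    have hd := ih (derivative W) hW' fun m hm => by
      simpa [Function.iterate_succ_apply] using h (m + 1) (by omega)
    set B := (∑ m ∈ Finset.range (d + 1), (r : ℝ) ^ m) * δ with hB
    -- A bound `B` on the derivative makes `W` vary by at most `B * r` on `[0, r]`; hence it stays
    -- that close to its mean over the central cell.
    have hlip : ∀ σ ∈ Set.Icc (0 : ℝ) r, |W.eval τ - W.eval σ| ≤ B * r := by
      intro σ hσ
      have h1 := Convex.norm_image_sub_le_of_norm_deriv_le (f := fun x => W.eval x)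
        (s := Set.Icc (0 : ℝ) r) (C := B) (fun x _ => W.differentiableAt)
        (fun x hx => by simpa using hd x hx) (convex_Icc _ _) hσ hτ
      refine h1.trans ?_
      have hB0 : 0 ≤ B := (abs_nonneg _).trans (hd τ hτ)
      refine mul_le_mul_of_nonneg_left ?_ hB0
      rw [Real.norm_eq_abs, abs_le]
      constructor <;> linarith [hσ.1, hσ.2, hτ.1, hτ.2]
    have hmean : |W.eval τ - ∫ σ in ((r : ℝ) - 1)..(r : ℝ), W.eval σ| ≤ B * r := by
      have h2 : W.eval τ - ∫ σ in ((r : ℝ) - 1)..(r : ℝ), W.eval σ =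
          ∫ σ in ((r : ℝ) - 1)..(r : ℝ), (W.eval τ - W.eval σ) := by
        rw [intervalIntegral.integral_sub (by simp)
          (W.continuous.intervalIntegrable _ _)]
        simp
      rw [h2]
      have := intervalIntegral.norm_integral_le_of_norm_le_const (a := (r : ℝ) - 1) (b := r)
        (f := fun σ => W.eval τ - W.eval σ) (C := B * r) fun σ hσ => by
          rw [Set.uIoc_of_le (by linarith)] at hσ
          exact hlip σ ⟨by linarith [hσ.1], hσ.2⟩
      simpa using this
    have h0 := h 0 (by omega)
    simp only [Function.iterate_zero, id] at h0
    have hsum : (∑ m ∈ Finset.range (d + 1 + 1), (r : ℝ) ^ m) * δ = δ + B * r := by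
      rw [Finset.sum_range_succ', hB]
      simp only [pow_succ, ← Finset.sum_mul, pow_zero]
      ring
    rw [hsum]
    have := abs_add_le (W.eval τ - ∫ σ in ((r : ℝ) - 1)..(r : ℝ), W.eval σ)
      (∫ σ in ((r : ℝ) - 1)..(r : ℝ), W.eval σ)
    rw [sub_add_cancel] at this
    linarith

/-- The energy controls the derivatives at `0` of orders `1, …, r - 1`. -/
theorem abs_eval_iterate_derivative_le (r l : ℕ) (hl : 1 ≤ l) (hl' : l ≤ r - 1) (p : ℝ[X])
    (hp : p.natDegree ≤ r - 1) :
    |(derivative^[l] p).eval 0| ≤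
      (∑ m ∈ Finset.range (r - 1 - l + 1), (r : ℝ) ^ m) * √(energy r p) := by
  refine abs_eval_le_of_abs_integral_le r (by omega) (r - 1 - l) _ ?_ ?_ 0 ⟨le_rfl, by positivity⟩
  · exact (natDegree_iterate_derivative p l).trans (by omega)
  · intro m hm
    rw [← Function.iterate_add_apply]
    exact abs_integral_iterate_derivative_le r (m + l) (by omega) (by omega) p

/-! ### Taylor polynomials on a stencil -/

/-- A function that is smooth at a point agrees near this point with a function that is `C^n`
everywhere. -/
theorem exists_contDiff_eventuallyEq {u : ℝ → ℝ} {x₀ : ℝ} {n : ℕ} (hu : ContDiffAt ℝ n u x₀) :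
    ∃ w : ℝ → ℝ, ContDiff ℝ n w ∧ w =ᶠ[𝓝 x₀] u := by
  obtain ⟨δ, hδ, hball⟩ := Metric.eventually_nhds_iff_ball.1 (hu.eventually (by simp))
  let χ : ContDiffBump x₀ := ⟨δ / 4, δ / 2, by linarith, by linarith⟩
  refine ⟨fun x => χ x * u x, contDiff_iff_contDiffAt.2 fun z => ?_, ?_⟩
  · by_cases hz : z ∈ Metric.ball x₀ δ
    · exact χ.contDiffAt.mul (hball z hz)
    · have hz' : z ∉ tsupport χ := by
        rw [χ.tsupport_eq]
        intro h
        have h1 : dist z x₀ ≤ δ / 2 := Metric.mem_closedBall.1 h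
        exact hz (Metric.mem_ball.2 (by linarith))
      have h0 : (fun x => χ x * u x) =ᶠ[𝓝 z] fun _ => 0 := by
        filter_upwards [notMem_tsupport_iff_eventuallyEq.1 hz'] with x hx
        simp [hx]
      exact contDiffAt_const.congr_of_eventuallyEq h0
  · filter_upwards [χ.eventuallyEq_one] with x hx
    simp [hx]

/-- A primitive of the Taylor polynomial of degree `r - 1` at `0` of the function `u (y + k τ)` of
`τ`. -/
def taylorPrimitive (r : ℕ) (u : ℝ → ℝ) (y k : ℝ) : ℝ[X] :=
  ∑ l ∈ Finset.range r, C (iteratedDeriv l u y * k ^ l / (l + 1).factorial) * X ^ (l + 1)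

theorem natDegree_taylorPrimitive_le (r : ℕ) (u : ℝ → ℝ) (y k : ℝ) :
    (taylorPrimitive r u y k).natDegree ≤ r := by
  refine natDegree_sum_le_of_forall_le _ _ fun l hl => ?_
  exact (natDegree_C_mul_X_pow_le _ _).trans (Finset.mem_range.1 hl)

theorem eval_derivative_taylorPrimitive (r : ℕ) (u : ℝ → ℝ) (y k τ : ℝ) :
    (derivative (taylorPrimitive r u y k)).eval τ =
      ∑ l ∈ Finset.range r, iteratedDeriv l u y * k ^ l / l.factorial * τ ^ l := by
  unfold taylorPrimitive
  rw [derivative_sum, eval_finsetSum]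
  refine Finset.sum_congr rfl fun l _ => ?_
  rw [derivative_C_mul_X_pow, eval_mul, eval_C, eval_X_pow, Nat.factorial_succ]
  have h1 : ((l + 1 : ℕ) : ℝ) ≠ 0 := by positivity
  have h2 : (l.factorial : ℝ) ≠ 0 := by positivity
  push_cast at h1 ⊢
  field_simp

theorem eval_iterate_derivative_taylorPrimitive (r l : ℕ) (hl : l < r) (u : ℝ → ℝ) (y k : ℝ) :
    (derivative^[l] (derivative (taylorPrimitive r u y k))).eval 0 =
      iteratedDeriv l u y * k ^ l := by
  rw [← Function.iterate_succ_apply, ← coeff_zero_eq_eval_zero, coeff_iterate_derivative]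
  have hc : (taylorPrimitive r u y k).coeff (0 + l.succ) =
      iteratedDeriv l u y * k ^ l / (l + 1).factorial := by
    simp [taylorPrimitive, finsetSum_coeff, coeff_X_pow, hl]
  rw [hc, zero_add, Nat.descFactorial_self]
  have h2 : ((l + 1).factorial : ℝ) ≠ 0 := by positivity
  simp only [nsmul_eq_mul, Nat.succ_eq_add_one]
  field_simp

theorem iteratedDeriv_comp_affine {u : ℝ → ℝ} {n : ℕ} (hu : ContDiff ℝ n u) (y k τ : ℝ) :
    iteratedDeriv n (fun τ => u (y + k * τ)) τ = k ^ n * iteratedDeriv n u (y + k * τ) := by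
  have h := congrFun (iteratedDeriv_comp_const_mul (n := n) (f := fun z => u (y + z))
    (hu.comp (contDiff_const.add contDiff_id)) k) τ
  rw [iteratedDeriv_comp_const_add] at h
  exact h

/-- Each derivative in `τ` brings out a factor `k`, so the remainder is of order `|k|^r`. The sign
of `k` is free because the mirrored stencil is traversed with `k = -Δx`. -/
theorem abs_sub_eval_taylor_le {r : ℕ} (hr : 1 ≤ r) {u : ℝ → ℝ} (hu : ContDiff ℝ r u)
    {y k M b : ℝ} (hM : ∀ τ ∈ Set.Icc 0 b, |iteratedDeriv r u (y + k * τ)| ≤ M) {τ : ℝ}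
    (hτ : τ ∈ Set.Icc 0 b) :
    |u (y + k * τ) - (derivative (taylorPrimitive r u y k)).eval τ| ≤ |k| ^ r * M * b ^ r := by
  obtain ⟨n, rfl⟩ : ∃ n, r = n + 1 := ⟨r - 1, by omega⟩
  -- For `b = 0` the interval is a point, without unique derivatives; both sides are then zero.
  rcases (hτ.1.trans hτ.2).eq_or_lt with hb | hb
  · subst hb
    obtain rfl : τ = 0 := le_antisymm hτ.2 hτ.1
    rw [eval_derivative_taylorPrimitive, Finset.sum_range_succ']
    simp
  have hM0 : 0 ≤ M := (abs_nonneg _).trans (hM τ hτ)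
  have hF : ∀ m ≤ n + 1, ContDiff ℝ m (fun τ => u (y + k * τ)) := fun m hm =>
    (hu.of_le (by exact_mod_cast hm)).comp (by fun_prop)
  have hder : ∀ m ≤ n + 1, ∀ σ ∈ Set.Icc 0 b,
      iteratedDerivWithin m (fun τ => u (y + k * τ)) (Set.Icc 0 b) σ =
        k ^ m * iteratedDeriv m u (y + k * σ) := fun m hm σ hσ => by
    rw [iteratedDerivWithin_eq_iteratedDeriv (uniqueDiffOn_Icc hb) (hF m hm).contDiffAt hσ,
      iteratedDeriv_comp_affine (hu.of_le (by exact_mod_cast hm))]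
  have h := taylor_mean_remainder_bound (f := fun τ => u (y + k * τ)) (C := |k| ^ (n + 1) * M)
    (n := n) hb.le (by exact_mod_cast (hF (n + 1) le_rfl).contDiffOn) hτ fun σ hσ => by
      rw [hder _ le_rfl σ hσ, norm_mul, norm_pow, Real.norm_eq_abs, Real.norm_eq_abs]
      exact mul_le_mul_of_nonneg_left (hM σ hσ) (by positivity)
  have hT : taylorWithinEval (fun τ => u (y + k * τ)) n (Set.Icc 0 b) 0 τ =
      (derivative (taylorPrimitive (n + 1) u y k)).eval τ := by
    rw [taylor_within_apply, eval_derivative_taylorPrimitive]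
    refine Finset.sum_congr rfl fun l hl => ?_
    rw [hder l (by simp at hl; omega) 0 ⟨le_rfl, hb.le⟩]
    simp
    ring
  rw [hT, Real.norm_eq_abs] at h
  refine h.trans ?_
  have h1 : (1 : ℝ) ≤ n.factorial := by exact_mod_cast Nat.factorial_pos n
  refine (div_le_self (mul_nonneg (by positivity) (pow_nonneg (by linarith [hτ.1]) _)) h1).trans ?_
  refine mul_le_mul_of_nonneg_left ?_ (by positivity)
  exact pow_le_pow_left₀ (by linarith [hτ.1]) (by linarith [hτ.2]) _

theorem abs_integral_sub_le {r : ℕ} (hr : 1 ≤ r) {u : ℝ → ℝ} (hu : ContDiff ℝ r u)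
    {y k M b : ℝ} (hM : ∀ τ ∈ Set.Icc 0 b, |iteratedDeriv r u (y + k * τ)| ≤ M) {i : ℕ}
    (hi : (i : ℝ) + 1 ≤ b) :
    |(∫ τ in (i : ℝ)..((i : ℝ) + 1), u (y + k * τ)) -
      ((taylorPrimitive r u y k).eval ((i + 1 : ℕ) : ℝ) -
        (taylorPrimitive r u y k).eval (i : ℝ))| ≤ |k| ^ r * M * b ^ r := by
  set Q := taylorPrimitive r u y k with hQ
  have hu' : Continuous u := hu.continuous
  have h1 : Q.eval ((i + 1 : ℕ) : ℝ) - Q.eval (i : ℝ) =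
      ∫ τ in (i : ℝ)..((i : ℝ) + 1), (derivative Q).eval τ := by
    rw [intervalIntegral.integral_eq_sub_of_hasDerivAt (f := fun τ => Q.eval τ)
      (fun τ _ => Q.hasDerivAt τ) ((derivative Q).continuous.intervalIntegrable _ _)]
    push_cast
    rfl
  rw [h1, ← intervalIntegral.integral_sub (Continuous.intervalIntegrable (by fun_prop) _ _)
    (Continuous.intervalIntegrable (by fun_prop) _ _)]
  have := intervalIntegral.norm_integral_le_of_norm_le_const (a := (i : ℝ)) (b := (i : ℝ) + 1)
    (f := fun τ => u (y + k * τ) - (derivative Q).eval τ) (C := |k| ^ r * M * b ^ r)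
    fun τ hτ => by
      rw [Set.uIoc_of_le (by linarith)] at hτ
      have : (0 : ℝ) ≤ i := Nat.cast_nonneg i
      exact abs_sub_eval_taylor_le hr hu hM ⟨by linarith [hτ.1], by linarith [hτ.2]⟩
  simpa using this

/-! ### Limits of the smoothness indicators and of the weights -/

/-- A perturbation of negligible energy does not change the energy to leading order. -/
theorem tendsto_energy_add_div {ι : Type*} {F : Filter ι} (r : ℕ) (p q : ι → ℝ[X])
    (hp : ∀ᶠ N in F, 0 < energy r (p N))
    (hq : Tendsto (fun N => energy r (q N) / energy r (p N)) F (𝓝 0)) :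
    Tendsto (fun N => energy r (p N + q N) / energy r (p N)) F (𝓝 1) := by
  rw [Metric.tendsto_nhds]
  intro η₀ hη₀
  -- With `η ≤ 1` the perturbed energy is at most `1 + 2η ≤ 3` times the original. The reverse
  -- comparison loses `3η + η`, whence `4 * η < η₀`.
  obtain ⟨η, hη, hη1, hη2⟩ : ∃ η : ℝ, 0 < η ∧ η ≤ 1 ∧ 4 * η < η₀ :=
    ⟨min 1 (η₀ / 8), by positivity, min_le_left _ _, by
      linarith [min_le_right 1 (η₀ / 8)]⟩
  have hc : 0 < 1 + 1 / η := by positivity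
  have hsmall : ∀ᶠ N in F, energy r (q N) / energy r (p N) < η / (1 + 1 / η) :=
    hq.eventually_lt_const (by positivity)
  filter_upwards [hp, hsmall] with N hN hs
  rw [lt_div_iff₀ hc, div_mul_eq_mul_div, div_lt_iff₀ hN] at hs
  have h1 := energy_add_le r (p N) (q N) hη
  -- The lower bound comes from the same inequality, with `p` written as `(p + q) + (-q)`.
  have h2 := energy_add_le r (p N + q N) (-q N) hη
  rw [add_neg_cancel_right, energy_neg] at h2
  have h3 : energy r (p N + q N) ≤ 3 * energy r (p N) := by nlinarith
  rw [Real.dist_eq, div_sub_one hN.ne', abs_div, abs_of_pos hN, div_lt_iff₀ hN, abs_lt]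
  constructor <;> nlinarith

/-- If the regularized smoothness indicators are asymptotically equal, then the weights of the
WENO-JS scheme tend to the ideal weights. -/
theorem tendsto_weightJS_of_tendsto_div {ι : Type*} {F : Filter ι} {r : ℕ} (hr : 1 ≤ r) {ε : ℝ}
    (v : ι → ℕ → ℝ) (D : ι → ℝ) (hD : ∀ᶠ N in F, 0 < D N)
    (h : ∀ s : Fin r, Tendsto (fun N => (ε + smoothness r s (v N)) / D N) F (𝓝 1)) (s : Fin r) :
    Tendsto (fun N => weightJS r ε (v N) s) F (𝓝 (idealWeight r s)) := by
  have h1 : ∀ s : Fin r, Tendsto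
      (fun N => idealWeight r s / ((ε + smoothness r s (v N)) / D N) ^ 2) F
      (𝓝 (idealWeight r s)) := fun s => by
    have := (tendsto_const_nhds (x := idealWeight r s)).div ((h s).pow 2) (by simp)
    rwa [one_pow, div_one] at this
  have h2 := (h1 s).div (tendsto_finsetSum Finset.univ fun l _ => h1 l)
    (by simp [sum_idealWeight r hr])
  rw [sum_idealWeight r hr, div_one] at h2
  refine h2.congr' ?_
  filter_upwards [hD] with N hN
  -- The weights are homogeneous, so the common factor `D N ^ 2` cancels. The identity survives a
  -- vanishing `ε + β_l`: division by zero makes both sides `0`.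
  have e : ∀ l : Fin r, idealWeight r l / ((ε + smoothness r l (v N)) / D N) ^ 2 =
      D N ^ 2 * (idealWeight r l / (ε + smoothness r l (v N)) ^ 2) := fun l => by
    rw [div_pow, div_div_eq_mul_div, mul_comm, mul_div_assoc]
  simp only [weightJS, normalize, Pi.div_apply, e, ← Finset.mul_sum]
  exact mul_div_mul_left _ _ (by positivity)

/-- Averages, in the coordinate `τ` of the stencil, of `u (y + k τ)`. -/
def scaledAverage (u : ℝ → ℝ) (y k : ℝ) (i : ℕ) : ℝ :=
  ∫ τ in (i : ℝ)..((i : ℝ) + 1), u (y + k * τ)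

/-- The whole stencil shrinks to `x₀`, so a property valid near `x₀` eventually holds on all of it
at once. -/
theorem eventually_forall_scaled {ι : Type*} {F : Filter ι} {y k : ι → ℝ} {x₀ : ℝ}
    (hy : Tendsto y F (𝓝 x₀)) (hk : Tendsto k F (𝓝 0)) {p : ℝ → Prop}
    (hp : ∀ᶠ x in 𝓝 x₀, p x) (b : ℝ) :
    ∀ᶠ N in F, ∀ τ ∈ Set.Icc 0 b, p (y N + k N * τ) := by
  obtain ⟨δ, hδ, hball⟩ := Metric.eventually_nhds_iff_ball.1 hp
  have h1 : Tendsto (fun N => |y N - x₀| + |k N| * |b|) F (𝓝 0) := by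
    simpa using (hy.sub_const x₀).abs.add (hk.abs.mul_const |b|)
  filter_upwards [h1.eventually_lt_const hδ] with N hN τ hτ
  refine hball _ ?_
  rw [Metric.mem_ball, Real.dist_eq]
  refine lt_of_le_of_lt ?_ hN
  rw [show y N + k N * τ - x₀ = (y N - x₀) + k N * τ by ring]
  refine (abs_add_le _ _).trans (add_le_add_right ?_ _)
  rw [abs_mul]
  refine mul_le_mul_of_nonneg_left ?_ (abs_nonneg _)
  rw [abs_of_nonneg hτ.1]
  exact hτ.2.trans (le_abs_self b)

theorem tendsto_scaledAverage {ι : Type*} {F : Filter ι} {y k : ι → ℝ} {x₀ : ℝ}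
    (hy : Tendsto y F (𝓝 x₀)) (hk : Tendsto k F (𝓝 0)) {u : ℝ → ℝ} (hu : Continuous u) (i : ℕ) :
    Tendsto (fun N => scaledAverage u (y N) (k N) i) F (𝓝 (u x₀)) := by
  rw [Metric.tendsto_nhds]
  intro η hη
  have h1 : ∀ᶠ x in 𝓝 x₀, |u x - u x₀| < η / 2 := by
    have := Metric.tendsto_nhds.1 (hu.tendsto x₀) (η / 2) (by positivity)
    simpa [Real.dist_eq] using this
  filter_upwards [eventually_forall_scaled hy hk h1 ((i : ℝ) + 1)] with N hN
  have h2 : scaledAverage u (y N) (k N) i - u x₀ =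
      ∫ τ in (i : ℝ)..((i : ℝ) + 1), (u (y N + k N * τ) - u x₀) := by
    rw [intervalIntegral.integral_sub (Continuous.intervalIntegrable (by fun_prop) _ _) (by simp)]
    simp [scaledAverage]
  rw [Real.dist_eq, h2]
  have := intervalIntegral.norm_integral_le_of_norm_le_const (a := (i : ℝ)) (b := (i : ℝ) + 1)
    (f := fun τ => u (y N + k N * τ) - u x₀) (C := η / 2) fun τ hτ => by
      rw [Set.uIoc_of_le (by linarith)] at hτ
      have : (0 : ℝ) ≤ i := Nat.cast_nonneg i
      exact (hN τ ⟨by linarith [hτ.1], hτ.2⟩).le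
  simp only [Real.norm_eq_abs, add_sub_cancel_left, abs_one, mul_one] at this
  linarith

/-- Near a point of smoothness the smoothness indicators tend to zero. -/
theorem tendsto_smoothness {ι : Type*} {F : Filter ι} {r : ℕ} (hr : 1 ≤ r) (s : ℕ)
    {v : ι → ℕ → ℝ} {c : ℝ} (hv : ∀ i < s + r, Tendsto (fun N => v N i) F (𝓝 c)) :
    Tendsto (fun N => smoothness r s (v N)) F (𝓝 0) := by
  obtain ⟨K, -, hK⟩ := exists_energy_reconPoly_le r s
  have hle : ∀ N, smoothness r s (v N) ≤
      K * (∑ i ∈ Finset.range (s + r), |v N i - c|) ^ 2 := fun N => by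
    -- The energy ignores constants, so only the deviations of the data from their common limit
    -- count.
    have h1 : reconPoly s r (v N) = reconPoly s r (fun i => v N i - c) + C c := by
      rw [← reconPoly_const s r hr c]
      simp only [← reconLinear_apply]
      rw [← map_add]
      congr 1
      ext i
      simp
    rw [smoothness_eq_energy, h1, energy_add_C]
    exact hK _ _ fun i hi => Finset.single_le_sum (f := fun i => |v N i - c|)
      (fun _ _ => abs_nonneg _) (Finset.mem_range.2 hi)
  refine squeeze_zero (fun N => energy_nonneg _ _) hle ?_
  have : Tendsto (fun N => ∑ i ∈ Finset.range (s + r), |v N i - c|) F (𝓝 0) := by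
    have := tendsto_finsetSum (Finset.range (s + r)) fun i hi =>
      ((hv i (Finset.mem_range.1 hi)).sub_const c).abs
    simpa using this
  simpa using (this.pow 2).const_mul K

/-- Near a point where a derivative of order `1, …, r - 1` does not vanish, each smoothness
indicator is asymptotic to the energy of the Taylor polynomial. -/
theorem exists_tendsto_smoothness_div {ι : Type*} {F : Filter ι} {r n : ℕ} (hn : n < r - 1)
    {u : ℝ → ℝ} (hu : ContDiff ℝ r u) {x₀ : ℝ} (hun : iteratedDeriv (n + 1) u x₀ ≠ 0)
    {y k : ι → ℝ} (hy : Tendsto y F (𝓝 x₀)) (hk : Tendsto k F (𝓝 0)) (hk0 : ∀ᶠ N in F, k N ≠ 0) :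
    ∃ D : ι → ℝ, (∀ᶠ N in F, 0 < D N) ∧ ∀ s : Fin r,
      Tendsto (fun N => smoothness r s (scaledAverage u (y N) (k N)) / D N) F (𝓝 1) := by
  set T : ι → ℝ[X] := fun N => derivative (taylorPrimitive r u (y N) (k N)) with hT
  have hTdeg : ∀ N, (T N).natDegree ≤ r - 1 := fun N =>
    (natDegree_derivative_le _).trans (Nat.sub_le_sub_right (natDegree_taylorPrimitive_le _ _ _ _) 1)
  set A : ℝ := ∑ m ∈ Finset.range (r - 1 - (n + 1) + 1), (r : ℝ) ^ m with hA
  have hr0 : (0 : ℝ) < r := by exact_mod_cast (by omega : 0 < r)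
  have hApos : 0 < A := Finset.sum_pos (fun _ _ => by positivity) ⟨0, by simp⟩
  set a := |iteratedDeriv (n + 1) u x₀| / 2 with ha
  have hapos : 0 < a := by have := abs_pos.2 hun; positivity
  -- lower bound for the energy of the Taylor polynomial
  have hcont : Continuous (iteratedDeriv (n + 1) u) :=
    hu.continuous_iteratedDeriv _ (by exact_mod_cast (by omega : n + 1 ≤ r))
  have hlow : ∀ᶠ N in F, (a / A) ^ 2 * |k N| ^ (2 * (r - 1)) ≤ energy r (T N) := by
    have h1 : ∀ᶠ N in F, a < |iteratedDeriv (n + 1) u (y N)| :=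
      ((hcont.tendsto x₀).comp hy).abs.eventually_const_lt (by
        have := abs_pos.2 hun
        simp only [ha]; linarith)
    have h2 : ∀ᶠ N in F, |k N| < 1 := by
      have := hk.abs
      rw [abs_zero] at this
      exact this.eventually_lt_const one_pos
    filter_upwards [h1, h2] with N h1 h2
    have h3 := abs_eval_iterate_derivative_le r (n + 1) (by omega) (by omega) (T N) (hTdeg N)
    rw [hT, eval_iterate_derivative_taylorPrimitive r (n + 1) (by omega), ← hA, abs_mul,
      abs_pow] at h3
    -- Here `n + 1 ≤ r - 1` enters: once `|k| < 1`, the exponent `r - 1` is the worst case, still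
    -- one below that of the remainder.
    have h4 : |k N| ^ (r - 1) ≤ |k N| ^ (n + 1) :=
      pow_le_pow_of_le_one (abs_nonneg _) h2.le (by omega)
    have h5 : a * |k N| ^ (r - 1) ≤ A * √(energy r (T N)) :=
      (mul_le_mul h1.le h4 (by positivity) (abs_nonneg _)).trans h3
    have h6 : a / A * |k N| ^ (r - 1) ≤ √(energy r (T N)) := by
      rw [div_mul_eq_mul_div, div_le_iff₀ hApos]
      linarith
    have h7 := pow_le_pow_left₀ (by positivity) h6 2
    rw [Real.sq_sqrt (energy_nonneg _ _)] at h7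
    calc _ = (a / A * |k N| ^ (r - 1)) ^ 2 := by ring
      _ ≤ _ := h7
  have hpos : ∀ᶠ N in F, 0 < energy r (T N) := by
    filter_upwards [hlow, hk0] with N h1 h2
    have := abs_pos.2 h2
    exact lt_of_lt_of_le (by positivity) h1
  refine ⟨fun N => energy r (T N), hpos, fun s => ?_⟩
  -- upper bound for the energy of the remainder
  have hcontr : Continuous (iteratedDeriv r u) := hu.continuous_iteratedDeriv _ le_rfl
  set M := |iteratedDeriv r u x₀| + 1 with hM
  -- The interval `[0, 2r]` contains every substencil, since `s + r ≤ 2r - 1`.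
  have hMev : ∀ᶠ N in F, ∀ τ ∈ Set.Icc (0 : ℝ) (2 * r),
      |iteratedDeriv r u (y N + k N * τ)| ≤ M := by
    refine eventually_forall_scaled hy hk (p := fun x => |iteratedDeriv r u x| ≤ M) ?_ _
    have h : ∀ᶠ x in 𝓝 x₀, |iteratedDeriv r u x| < M :=
      (hcontr.tendsto x₀).abs.eventually_lt_const (by simp [hM])
    exact h.mono fun _ h => h.le
  obtain ⟨K, hK0, hK⟩ := exists_energy_reconPoly_le r s
  set w : ι → ℕ → ℝ := fun N i => (taylorPrimitive r u (y N) (k N)).eval ((i + 1 : ℕ) : ℝ) -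
    (taylorPrimitive r u (y N) (k N)).eval (i : ℝ) with hw
  -- The reconstruction is linear and exact on the Taylor polynomial, so only the Taylor remainder
  -- of the averages depends on `s`.
  have hdecomp : ∀ N, reconPoly s r (scaledAverage u (y N) (k N)) =
      T N + reconPoly s r (scaledAverage u (y N) (k N) - w N) := fun N => by
    rw [hT]
    simp only
    rw [← reconPoly_eval_sub s r _ (natDegree_taylorPrimitive_le r u (y N) (k N))]
    simp only [← reconLinear_apply, map_sub, hw]
    ring
  simp only [smoothness_eq_energy, hdecomp]
  refine tendsto_energy_add_div r T _ hpos ?_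
  set B := M * (2 * (r : ℝ)) ^ r with hB
  have hup : ∀ᶠ N in F, energy r (reconPoly s r (scaledAverage u (y N) (k N) - w N)) ≤
      K * (|k N| ^ r * B) ^ 2 := by
    filter_upwards [hMev] with N hN
    refine hK _ _ fun i hi => ?_
    have hs := s.2
    have hi' : (i : ℝ) + 1 ≤ 2 * r := by exact_mod_cast (by omega : i + 1 ≤ 2 * r)
    have := abs_integral_sub_le (by omega) hu hN hi'
    rw [hB, ← mul_assoc]
    exact this
  refine squeeze_zero' (g := fun N => K * B ^ 2 / (a / A) ^ 2 * |k N| ^ 2)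
    (Eventually.of_forall fun N =>
    div_nonneg (energy_nonneg _ _) (energy_nonneg _ _)) ?_ ?_
  · filter_upwards [hup, hlow, hpos, hk0] with N h1 h2 h3 h4
    rw [div_le_iff₀ h3]
    refine h1.trans ?_
    have hkk : |k N| ^ r = |k N| ^ (r - 1) * |k N| := by
      rw [← pow_succ, show r - 1 + 1 = r by omega]
    have e : K * (|k N| ^ r * B) ^ 2 = K * B ^ 2 / (a / A) ^ 2 * |k N| ^ 2 *
        ((a / A) ^ 2 * |k N| ^ (2 * (r - 1))) := by
      rw [hkk, pow_mul']
      field_simp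
    rw [e]
    exact mul_le_mul_of_nonneg_left h2 (by positivity)
  · have := hk.abs.pow 2
    rw [abs_zero, zero_pow two_ne_zero] at this
    simpa using this.const_mul (K * B ^ 2 / (a / A) ^ 2)

theorem smoothness_congr (r s : ℕ) {v w : ℕ → ℝ} (h : ∀ i < s + r, v i = w i) :
    smoothness r s v = smoothness r s w := by
  rw [smoothness_eq_energy, smoothness_eq_energy, reconPoly_congr s r h]

/-- On stencils that shrink to a point of smoothness the weights of the WENO-JS scheme tend to the
ideal weights. -/
theorem tendsto_weightJS {ι : Type*} {F : Filter ι} {r : ℕ} (hr : 1 ≤ r) {ε : ℝ} {u : ℝ → ℝ}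
    {x₀ : ℝ} (hu : ContDiffAt ℝ r u x₀)
    (hε : 0 < ε ∨ ε = 0 ∧ ∃ n, n < r - 1 ∧ iteratedDeriv (n + 1) u x₀ ≠ 0)
    {y k : ι → ℝ} (hy : Tendsto y F (𝓝 x₀)) (hk : Tendsto k F (𝓝 0)) (hk0 : ∀ᶠ N in F, k N ≠ 0)
    {v : ι → ℕ → ℝ} (hv : ∀ᶠ N in F, ∀ i, v N i = scaledAverage u (y N) (k N) i) (s : Fin r) :
    Tendsto (fun N => weightJS r ε (v N) s) F (𝓝 (idealWeight r s)) := by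
  obtain ⟨w, hw, hwu⟩ := exists_contDiff_eventuallyEq hu
  -- The indicators see only values near `x₀`, so `u` may be replaced by a globally smooth function.
  have hsm : ∀ᶠ N in F, ∀ s : Fin r,
      smoothness r s (v N) = smoothness r s (scaledAverage w (y N) (k N)) := by
    filter_upwards [hv, eventually_forall_scaled hy hk hwu (2 * r)] with N h1 h2 s
    refine smoothness_congr r s fun i hi => ?_
    have hs := s.2
    have hi' : (i : ℝ) + 1 ≤ 2 * r := by exact_mod_cast (by omega : i + 1 ≤ 2 * r)
    have hi0 : (0 : ℝ) ≤ i := Nat.cast_nonneg i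
    rw [h1]
    refine intervalIntegral.integral_congr fun τ hτ => ?_
    rw [Set.uIcc_of_le (by linarith)] at hτ
    exact (h2 τ ⟨by linarith [hτ.1], by linarith [hτ.2]⟩).symm
  rcases hε with hε | ⟨rfl, n, hn, hun⟩
  · refine tendsto_weightJS_of_tendsto_div hr v (fun _ => ε) (Eventually.of_forall fun _ => hε)
      (fun s => ?_) s
    have h0 := tendsto_smoothness hr s (c := w x₀) fun i _ =>
      tendsto_scaledAverage hy hk hw.continuous i
    have h1 := (h0.const_add ε).div_const ε
    rw [add_zero, div_self hε.ne'] at h1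
    refine h1.congr' ?_
    filter_upwards [hsm] with N hN
    rw [hN]
  · rw [← hwu.iteratedDeriv_eq] at hun
    obtain ⟨D, hD, h⟩ := exists_tendsto_smoothness_div hn hw hun hy hk hk0
    refine tendsto_weightJS_of_tendsto_div hr v D hD (fun s => ?_) s
    refine (h s).congr' ?_
    filter_upwards [hsm] with N hN
    rw [hN, zero_add]

/-! ### The selected index -/

/-- The distance to `d s` tends to `0`, the distance to any other `d i` to `|d s - d i| > 0`. The
minimizer is eventually unique, so the tie-breaking rule plays no role. -/
theorem eventually_minDist_eq {ι : Type*} {F : Filter ι} {r : ℕ} [NeZero r] {A : Type*}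
    (x : Fin r → A) {d : Fin r → ℝ} (hd : Function.Injective d) {w : ι → ℝ} {s : Fin r}
    (hw : Tendsto w F (𝓝 (d s))) : ∀ᶠ N in F, minDist x d (w N) = x s := by
  have h : ∀ᶠ N in F, ∀ i, i ≠ s → |w N - d s| < |w N - d i| := by
    rw [eventually_all]
    intro i
    by_cases hi : i = s
    · exact Eventually.of_forall fun _ h => absurd hi h
    · have h1 : Tendsto (fun N => |w N - d s| - |w N - d i|) F (𝓝 (|d s - d s| - |d s - d i|)) :=
        (hw.sub_const _).abs.sub (hw.sub_const _).abs
      have h2 : |d s - d s| - |d s - d i| < 0 := by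
        simp [sub_ne_zero, hd.ne (Ne.symm hi)]
      filter_upwards [h1.eventually_lt_const h2] with N hN _
      linarith
  filter_upwards [h] with N hN
  have hset : indexOfMin d (w N) = {s} := by
    ext i
    simp only [indexOfMin, Finset.mem_filter, Finset.mem_univ, true_and, Finset.mem_singleton]
    constructor
    · intro hi
      by_contra hne
      exact absurd (hi s) (not_le.2 (hN i hne))
    · intro his l
      rw [his]
      by_cases hl : l = s
      · rw [hl]
      · exact (hN l hl).le
  unfold minDist
  congr 1
  simp [hset]

/-- Once the weights of the WENO-JS scheme are close to the ideal weights, the MOP-WENO-X and WENO-X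
weights agree. -/
theorem eventually_weightMOP_eq {ι : Type*} {F : Filter ι} {r : ℕ} [NeZero r] {ε : ℝ} {mP : ℕ}
    (g : (Fin mP → ℝ) → ℝ → ℝ) (P : Fin r → Fin mP → ℝ) {v : ι → ℕ → ℝ}
    (h : ∀ s, Tendsto (fun N => weightJS r ε (v N) s) F (𝓝 (idealWeight r s))) :
    ∀ᶠ N in F, weightMOP r ε g P (v N) = weightX r ε g P (v N) := by
  have h1 := eventually_all.2 fun s => eventually_minDist_eq P (idealWeight_injective r) (h s)
  filter_upwards [h1] with N hN
  simp only [weightMOP, weightX, hN]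

/-! ### The cell averages on the stencils -/

theorem cellRight_eq (xl xr : ℝ) (N : ℕ) (j : ℤ) :
    cellRight xl xr N j = xl + j * meshSize xl xr N := by
  unfold cellRight cellCenter
  ring

theorem tendsto_meshSize (xl xr : ℝ) : Tendsto (meshSize xl xr) atTop (𝓝 0) :=
  tendsto_const_div_atTop_nhds_zero_nat _

theorem tendsto_cellRight_add {xl xr x₀ : ℝ} {j : ℕ → ℤ}
    (hj : Tendsto (fun N => cellCenter xl xr N (j N)) atTop (𝓝 x₀)) (c : ℤ) :
    Tendsto (fun N => cellRight xl xr N (j N + c)) atTop (𝓝 x₀) := by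
  have := hj.add ((tendsto_meshSize xl xr).const_mul ((c : ℝ) + 1 / 2))
  rw [mul_zero, add_zero] at this
  refine this.congr fun N => ?_
  rw [cellRight_eq]
  unfold cellCenter
  push_cast
  ring

/-- Substitution `x = y + Δx τ`, with `y` the left edge of cell `j - (r - 1)`, that is, the right
edge of cell `j - r`. -/
theorem stencil_cellAverage (r : ℕ) (u : ℝ → ℝ) (xl xr : ℝ) (N : ℕ) (j : ℤ) (i : ℕ)
    (h : meshSize xl xr N ≠ 0) :
    stencil r (cellAverage u xl xr N) j i =
      scaledAverage u (cellRight xl xr N (j - r)) (meshSize xl xr N) i := by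
  unfold stencil cellAverage scaledAverage
  rw [intervalIntegral.integral_comp_add_mul u h]
  simp only [cellRight_eq, smul_eq_mul, one_div]
  congr 2 <;> push_cast <;> ring

/-- The same substitution from the right edge of the stencil with slope `-Δx`; the sign of the
reversed orientation cancels that of the Jacobian. -/
theorem mirrorStencil_cellAverage (r : ℕ) (u : ℝ → ℝ) (xl xr : ℝ) (N : ℕ) (j : ℤ) (i : ℕ)
    (h : meshSize xl xr N ≠ 0) :
    mirrorStencil r (cellAverage u xl xr N) j i =
      scaledAverage u (cellRight xl xr N (j + (r - 1))) (-meshSize xl xr N) i := by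
  unfold mirrorStencil cellAverage scaledAverage
  rw [intervalIntegral.integral_comp_add_mul u (neg_ne_zero.2 h), intervalIntegral.integral_symm]
  simp only [cellRight_eq, smul_eq_mul, one_div, inv_neg, neg_mul, mul_neg]
  congr 3 <;> push_cast <;> ring

end WENO

end

/-! ### Equality of the two schemes near `x₀` and equivalence of their orders -/

open WENO in
theorem mainTheorem3 (r : ℕ) [NeZero r] (hr : 2 ≤ r)
    -- the mapping functions `g (P s)` of the scheme X, with `mP` parameters for each substencil
    (mP : ℕ) (g : (Fin mP → ℝ) → ℝ → ℝ) (P : Fin r → Fin mP → ℝ)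
    -- the conservation law, the mesh and the solution at the given time
    (f : ℝ → ℝ) (hf : Differentiable ℝ f) (xl xr : ℝ) (u : ℝ → ℝ)
    (α : ℝ) (hα : IsLUB ((fun v => |deriv f v|) '' (u '' Set.Icc xl xr)) α)
    -- a point at which the solution is smooth, and cells that approach it
    (x₀ : ℝ) (hx₀ : x₀ ∈ Set.Ioo xl xr) (hu : ContDiffAt ℝ ∞ u x₀)
    (j : ℕ → ℤ) (hj : Tendsto (fun N => WENO.cellCenter xl xr N (j N)) atTop (𝓝 x₀))
    -- `ε = 0` is the convention of the order analysis at critical points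
    (ε : ℝ) (hε : 0 ≤ ε)
    (hcp : 0 < ε ∨ ∃ n, n < r - 1 ∧ WENO.HasCriticalOrder u x₀ n) :
    (WENO.HasOptimalOrder r (WENO.weightMOP r ε g P) f α u xl xr j ↔
      WENO.HasOptimalOrder r (WENO.weightX r ε g P) f α u xl xr j) ∧
    (∀ p : ℝ, WENO.HasOrder r (WENO.weightMOP r ε g P) f α u xl xr j p ↔
      WENO.HasOrder r (WENO.weightX r ε g P) f α u xl xr j p) ∧
    (∀ (p : ℝ) (s : Fin r),
      ((fun N => WENO.weightMOP r ε g P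
          (WENO.stencil r (WENO.cellAverage u xl xr N) (j N)) s - WENO.idealWeight r s)
        =O[atTop] fun N => WENO.meshSize xl xr N ^ p) ↔
      ((fun N => WENO.weightX r ε g P
          (WENO.stencil r (WENO.cellAverage u xl xr N) (j N)) s - WENO.idealWeight r s)
        =O[atTop] fun N => WENO.meshSize xl xr N ^ p)) ∧
    (∀ (p : ℝ) (s : Fin r),
      ((fun N => WENO.weightMOP r ε g P
          (WENO.mirrorStencil r (WENO.cellAverage u xl xr N) (j N)) s - WENO.idealWeight r s)
        =O[atTop] fun N => WENO.meshSize xl xr N ^ p) ↔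
      ((fun N => WENO.weightX r ε g P
          (WENO.mirrorStencil r (WENO.cellAverage u xl xr N) (j N)) s - WENO.idealWeight r s)
        =O[atTop] fun N => WENO.meshSize xl xr N ^ p)) := by
  have hε' : 0 < ε ∨ ε = 0 ∧ ∃ n, n < r - 1 ∧ iteratedDeriv (n + 1) u x₀ ≠ 0 := by
    rcases hε.eq_or_lt with h | h
    · rcases hcp with h' | ⟨n, hn, hc⟩
      · exact Or.inl h'
      · exact Or.inr ⟨h.symm, n, hn, hc.2⟩
    · exact Or.inl h
  have hur : ContDiffAt ℝ r u x₀ := hu.of_le (by exact_mod_cast le_top)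
  -- At `N = 0` the mesh size is `0` by the convention on division.
  have hmesh : ∀ᶠ N in atTop, meshSize xl xr N ≠ 0 := by
    filter_upwards [eventually_gt_atTop 0] with N hN
    exact div_ne_zero (by linarith [hx₀.1, hx₀.2]) (by positivity)
  have hst : ∀ c : ℤ, ∀ᶠ N in atTop,
      weightMOP r ε g P (stencil r (cellAverage u xl xr N) (j N + c)) =
        weightX r ε g P (stencil r (cellAverage u xl xr N) (j N + c)) := fun c => by
    refine eventually_weightMOP_eq g P fun s => tendsto_weightJS (by omega) hur hε'
      (tendsto_cellRight_add hj (c - r)) (tendsto_meshSize xl xr) hmesh ?_ s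
    filter_upwards [hmesh] with N hN i
    rw [stencil_cellAverage r u xl xr N _ i hN, add_sub_assoc]
  have hmi : ∀ c : ℤ, ∀ᶠ N in atTop,
      weightMOP r ε g P (mirrorStencil r (cellAverage u xl xr N) (j N + c)) =
        weightX r ε g P (mirrorStencil r (cellAverage u xl xr N) (j N + c)) := fun c => by
    have hk : Tendsto (fun N => -meshSize xl xr N) atTop (𝓝 0) := by
      simpa using (tendsto_meshSize xl xr).neg
    refine eventually_weightMOP_eq g P fun s => tendsto_weightJS (by omega) hur hε'
      (tendsto_cellRight_add hj (c + (r - 1))) hk (hmesh.mono fun _ h => neg_ne_zero.2 h) ?_ s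
    filter_upwards [hmesh] with N hN i
    rw [mirrorStencil_cellAverage r u xl xr N _ i hN, add_assoc]
  have hs0 := hst 0
  have hm0 := hmi 0
  simp only [add_zero] at hs0 hm0
  have hT : (fun N => truncationError r (weightMOP r ε g P) f α u xl xr N (j N)) =ᶠ[atTop]
      fun N => truncationError r (weightX r ε g P) f α u xl xr N (j N) := by
    -- The flux at `x_{j+1/2}` uses the stencil around `j` and the mirrored one around `j + 1`; the
    -- flux at `x_{j-1/2}` uses those around `j - 1` and `j`.
    filter_upwards [hs0, hst (-1), hm0, hmi 1] with N h1 h2 h3 h4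
    rw [← sub_eq_add_neg] at h2
    simp only [truncationError, spatialOp, numFlux, uMinus, uPlus, weno, sub_add_cancel, h1, h2,
      h3, h4]
  have hO : ∀ p : ℝ, HasOrder r (weightMOP r ε g P) f α u xl xr j p ↔
      HasOrder r (weightX r ε g P) f α u xl xr j p := fun p =>
    isBigO_congr hT EventuallyEq.rfl
  refine ⟨hO _, hO, fun p s => isBigO_congr ?_ EventuallyEq.rfl,
    fun p s => isBigO_congr ?_ EventuallyEq.rfl⟩
  · filter_upwards [hs0] with N h
    rw [h]
  · filter_upwards [hm0] with N h
    rw [h]
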